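/- Let $n\ge 1$ and let $A_1,\dots,A_n$ be probability distributions on $\mathbb{R}$ such that, for each $i$, the function $x\mapsto x\cdot\Pr_{a\sim A_i}[|a|\ge x]$ is bounded on $[0,\infty)$. Item $i$ has an unknown value $v_i\in\mathbb{R}$ and is observed as $s_i=v_i+a_i$, where the noises $a_i\sim A_i$ are mutually independent. An algorithm (possibly randomized, and allowed to depend on $A_1,\dots,A_n$) receives $s=(s_1,\dots,s_n)$ and selects one item $\mathrm{Alg}(s)\in\{1,\dots,n\}$. Put $$\mathrm{Reg}(\mathrm{Alg}):=\sup_{v\in\mathbb{R}^n}\Big(\max_i v_i-\mathbb{E}\big[v_{\mathrm{Alg}(v+a)}\big]\Big),\qquad \mathrm{OPT}:=\inf_{\mathrm{Alg}}\mathrm{Reg}(\mathrm{Alg}).$$ $\mathrm{Greedy}$ selects an item maximizing $s_i$, and, for a vector of offsets $\theta_1,\dots,\theta_n$, $\mathrm{Offset}_\theta$ selects an item maximizing $s_i-\theta_i$ (ties are broken in any way). Here $\theta_i=\theta(A_i)$, where $\theta(D)$ denotes a minimizer over $t\in\mathbb{R}$ of $$\max\Big(\sup_{v>0}\ v\cdot\Pr_{a\sim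 D}[a\le t-v],\ \ \sup_{v<0}\ (-v)\cdot\Pr_{a\sim D}[a\ge t-v]\Big).$$ Suppose that every $A_i$ is symmetric, that is, $\Pr_{a\sim A_i}[a>x]=\Pr_{a\sim A_i}[a<-x]$ for every $x\in\mathbb{R}$. Then: 1. For each $i$, $0$ is such a minimizer for $D=A_i$, and it is the only one if $\mathbb{E}_{a\sim A_i}|a|<\infty$. So $\theta(A_i)=0$ (when $\mathbb{E}_{a\sim A_i}|a|=\infty$, the minimizer need not be unique, and we choose $\theta(A_i)=0$). 2. Consequently $\mathrm{Offset}_\theta$ coincides with $\mathrm{Greedy}$: an algorithm is an $\mathrm{Offset}_\theta$ algorithm if and only if it is a $\mathrm{Greedy}$ algorithm. 3. $\mathrm{Reg}(\mathrm{Greedy})\le 57000\cdot\mathrm{OPT}$, for every way of breaking ties. -/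

import Mathlib

open MeasureTheory ProbabilityTheory
open scoped ENNReal

namespace NoisySelection

/-- A distribution `D` on the real line is symmetric: `Pr[D > x] = Pr[D < -x]` for every `x`. -/
def IsSymmetric (D : Measure ℝ) : Prop :=
  ∀ x : ℝ, D (Set.Ioi x) = D (Set.Iio (-x))

/-- The function `x ↦ Pr[|a| ≥ x] * x` is bounded on `[0, ∞)`. -/
def HasBoundedTail (D : Measure ℝ) : Prop :=
  ∃ C : ℝ, ∀ x : ℝ, 0 ≤ x → D.real {a : ℝ | x ≤ |a|} * x ≤ C

/-- The worst-case regret of the threshold `t` for one item with noise `D` against a noiseless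
item of value `0`. -/
noncomputable def thresholdCost (D : Measure ℝ) (t : ℝ) : ℝ≥0∞ :=
  max (⨆ (v : ℝ) (_ : 0 < v), D (Set.Iic (t - v)) * ENNReal.ofReal v)
    (⨆ (v : ℝ) (_ : v < 0), D (Set.Ici (t - v)) * ENNReal.ofReal (-v))

/-- `t` is a possible value of `θ(D)`: it minimizes `thresholdCost D` over the real line. -/
def IsTheta (D : Measure ℝ) (t : ℝ) : Prop :=
  ∀ t' : ℝ, thresholdCost D t ≤ thresholdCost D t'

/-- A (possibly randomized) algorithm for `n` items: given the vector of observed values, it draws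
the selected item. Algorithms are the Markov kernels of this type. -/
abbrev Algorithm (n : ℕ) := Kernel (Fin n → ℝ) (Fin n)

/-- The expected intrinsic value of the item that `alg` picks on the observed values `s`. -/
noncomputable def pickedValue {n : ℕ} (alg : Algorithm n) (v s : Fin n → ℝ) : ℝ :=
  ∑ i, (alg s).real {i} * v i

/-- The regret of `alg` at the intrinsic values `v`, for independent noises `a i ∼ A i`. -/
noncomputable def regretAt {n : ℕ} (A : Fin n → Measure ℝ) (alg : Algorithm n)
    (v : Fin n → ℝ) : ℝ :=
  (⨆ i, v i) - ∫ a, pickedValue alg v (v + a) ∂(Measure.pi A)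

/-- The regret at any vector of values is nonnegative, so that no information is lost by
`ENNReal.ofReal` in `regret`. -/
theorem regretAt_nonneg {n : ℕ} (A : Fin n → Measure ℝ) [∀ i, IsProbabilityMeasure (A i)]
    (alg : Algorithm n) [IsMarkovKernel alg] (v : Fin n → ℝ) : 0 ≤ regretAt A alg v := by
  have hone : ∀ s : Fin n → ℝ, ∑ i, (alg s).real {i} = 1 := by
    intro s
    have h := measureReal_biUnion_finset (μ := alg s) (s := Finset.univ)
      (f := fun i : Fin n => ({i} : Set (Fin n)))
      (fun i _ j _ hij => Set.disjoint_singleton.2 hij) (fun i _ => MeasurableSet.singleton i)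
    rw [← h]
    have : (⋃ b ∈ (Finset.univ : Finset (Fin n)), ({b} : Set (Fin n))) = Set.univ := by
      ext x; simp
    rw [this]
    exact probReal_univ
  have hint : Integrable (fun a => pickedValue alg v (v + a)) (Measure.pi A) := by
    unfold pickedValue
    refine integrable_finsetSum _ fun i _ => Integrable.mul_const ?_ _
    refine Integrable.of_bound (C := 1) (Measurable.aestronglyMeasurable ?_)
      (Filter.Eventually.of_forall fun a => ?_)
    · exact ((Kernel.measurable_coe alg (MeasurableSet.singleton i)).comp
        (measurable_const_add v)).ennreal_toReal
    · rw [Real.norm_of_nonneg measureReal_nonneg]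
      exact measureReal_le_one
  have hle : ∀ a, pickedValue alg v (v + a) ≤ ⨆ i, v i := by
    intro a
    calc pickedValue alg v (v + a)
        ≤ ∑ i, (alg (v + a)).real {i} * (⨆ i, v i) :=
          Finset.sum_le_sum fun i _ => mul_le_mul_of_nonneg_left
            (le_ciSup (Set.finite_range v).bddAbove i) measureReal_nonneg
      _ = ⨆ i, v i := by rw [← Finset.sum_mul, hone, one_mul]
  have h := integral_mono hint (integrable_const (⨆ i, v i)) hle
  simp only [integral_const, probReal_univ, one_smul] at h
  exact sub_nonneg.2 h

/-- The overall regret: the supremum of the regret over all vectors of intrinsic values. -/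
noncomputable def regret {n : ℕ} (A : Fin n → Measure ℝ) (alg : Algorithm n) : ℝ≥0∞ :=
  ⨆ v : Fin n → ℝ, ENNReal.ofReal (regretAt A alg v)

/-- The optimal regret: the infimum of the overall regret over all randomized algorithms. -/
noncomputable def optRegret {n : ℕ} (A : Fin n → Measure ℝ) : ℝ≥0∞ :=
  ⨅ (alg : Algorithm n) (_ : IsMarkovKernel alg), regret A alg

/-- `alg` always picks an item with the highest observed value (ties broken in any way). -/
def IsGreedy {n : ℕ} (alg : Algorithm n) : Prop :=
  ∀ s : Fin n → ℝ, alg s {i | ∀ j, s j ≤ s i} = 1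

/-- `alg` always picks an item that maximizes `s i - θ i` (ties broken in any way). -/
def IsOffset {n : ℕ} (θ : Fin n → ℝ) (alg : Algorithm n) : Prop :=
  ∀ s : Fin n → ℝ, alg s {i | ∀ j, s j - θ j ≤ s i - θ i} = 1

end NoisySelection

/-!
Greedy is a constant-factor approximation because its loss can be bounded by quantities of the form
`∑ i ∈ S, g i * Pr[a i ≥ g i]`, and because every algorithm has to pay for such quantities.

*Every algorithm pays* (`sum_mul_tail_le_of_regret_le`). Let `b` be an independent copy of the noise
vector `a`, give the items `i ∈ S` the random values `b i - g i / 2`, and all others the value `0`.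
The observation of item `i` is then `a i + b i - g i / 2`, which is symmetric in `a i` and `b i`: it
is impossible to distinguish a good item with a low noise (`b i ≥ g i`, `a i ≤ 0`) from a bad item
with a high noise (`b i ≤ 0`, `a i ≥ g i`). In the first case not picking `i` costs `g i / 2`, in the
second case picking it costs `g i / 2`, so whatever the algorithm does, it loses
`g i / 2 * Pr[a i ≥ g i] * Pr[a i ≤ 0]` on item `i`, on the event that no other item of `S` is good.
Values `0 < b i < g i` are replaced by `b i = 0`, so that an item is good with probability
exactly `Pr[a i ≥ g i]`.

*Greedy does not lose more* (`greedy_regretAt_le`). Let `m` and `k` be the best and the second best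
item, and let `Ω` be at least the regret of some algorithm. If greedy picks an item `i ≠ m` with gap
`G = v m - v i`, then, by `gap_le_of_forall_obs_le`, either `a i ≥ G / 4`, or both `|a m|` and `|a k|`
are at least `G / 4`, or `G` is comparable to `v m - v k` and `a m` is below `-(v m - v k) / 2`. The
last case costs `O(Ω)` by the lower bound for the single item `m`, the second one by
`lintegral_min_abs_le`, since the smaller of two independent noises with tails `O(Ω / t)` has mean
`O(Ω)`. In the first case, gaps of order `Ω` are harmless, and for the items with larger gaps
the probabilities `Pr[a i ≥ G / 4]` have a small sum, as otherwise a subfamily with sum of order one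
would contradict the lower bound; so the lower bound applies to all of them together
(`sum_mul_tail_le_of_large`).

The threshold `0` is optimal for symmetric noise since the two suprema in `thresholdCost D t` are
the values at `t` and at `-t` of one monotone function (`IsSymmetric.thresholdCost_eq`), and this
function increases strictly to the right of `0` if the mean is finite
(`IsSymmetric.lowerCost_zero_lt`).
-/

namespace NoisySelection

variable {n : ℕ} {A : Fin n → Measure ℝ}

/-- The regret as the expected gap of the picked item, in `ℝ≥0∞`, where the lower bound needs no
integrability considerations. -/
theorem ofReal_regretAt_eq_lintegral [∀ i, IsProbabilityMeasure (A i)]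
    (alg : Algorithm n) [IsMarkovKernel alg] (v : Fin n → ℝ) :
    ENNReal.ofReal (regretAt A alg v) =
      ∫⁻ a, ∑ i, alg (v + a) {i} * ENNReal.ofReal ((⨆ j, v j) - v i) ∂Measure.pi A := by
  have hmeas : ∀ i, Measurable fun a : Fin n → ℝ => (alg (v + a)).real {i} := fun i =>
    ((Kernel.measurable_coe alg (MeasurableSet.singleton i)).comp
        (measurable_const_add v)).ennreal_toReal
  have hint : ∀ c : Fin n → ℝ,
      Integrable (fun a => ∑ i, (alg (v + a)).real {i} * c i) (Measure.pi A) := by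
    intro c
    refine integrable_finsetSum _ fun i _ => Integrable.mul_const ?_ _
    refine Integrable.of_bound (C := 1) (hmeas i).aestronglyMeasurable
      (Filter.Eventually.of_forall fun a => ?_)
    rw [Real.norm_of_nonneg measureReal_nonneg]
    exact measureReal_le_one
  have hone : ∀ s : Fin n → ℝ, ∑ i, (alg s).real {i} = 1 := by
    intro s
    have h := sum_measureReal_singleton (μ := alg s) Finset.univ
    rw [h]
    simp
  have hgap : ∀ i, 0 ≤ (⨆ j, v j) - v i := fun i =>
    sub_nonneg.2 (le_ciSup (Set.finite_range v).bddAbove i)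
  have heq : regretAt A alg v
      = ∫ a, ∑ i, (alg (v + a)).real {i} * ((⨆ j, v j) - v i) ∂Measure.pi A := by
    unfold regretAt pickedValue
    have : ∀ a : Fin n → ℝ, ∑ i, (alg (v + a)).real {i} * ((⨆ j, v j) - v i)
        = (⨆ j, v j) - ∑ i, (alg (v + a)).real {i} * v i := by
      intro a
      simp_rw [mul_sub, Finset.sum_sub_distrib, ← Finset.sum_mul, hone, one_mul]
    simp_rw [this]
    rw [integral_sub (integrable_const _) (hint v)]
    simp
  rw [heq, ofReal_integral_eq_lintegral_ofReal (hint _)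
    (Filter.Eventually.of_forall fun a => Finset.sum_nonneg fun i _ =>
      mul_nonneg measureReal_nonneg (hgap i))]
  refine lintegral_congr fun a => ?_
  rw [ENNReal.ofReal_sum_of_nonneg fun i _ => mul_nonneg measureReal_nonneg (hgap i)]
  refine Finset.sum_congr rfl fun i _ => ?_
  rw [ENNReal.ofReal_mul measureReal_nonneg, ofReal_measureReal]

/-! ### A hard prior built from a second copy of the noise -/

/-- The vector of values built from a second copy `b` of the noise: the items outside `S` have
value `0`, and item `i ∈ S` has value `b i - g i / 2`, where the intermediate range
`0 < b i < g i` is collapsed to `b i = 0`. -/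
noncomputable def hardValue (S : Finset (Fin n)) (g b : Fin n → ℝ) (i : Fin n) : ℝ :=
  if i ∈ S then (if 0 < b i ∧ b i < g i then 0 else b i) - g i / 2 else 0

/-- Pairs `(a j, b j)` for which item `i` is bad (`b i ≤ 0`) but looks good thanks to its noise
(`g i ≤ a i`), while every other item of `S` is bad. -/
def lowEvent (S : Finset (Fin n)) (g : Fin n → ℝ) (i : Fin n) : Set (Fin n → ℝ × ℝ) :=
  {w | g i ≤ (w i).1 ∧ (w i).2 ≤ 0 ∧ ∀ j ∈ S, j ≠ i → (w j).2 < g j}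

/-- Pairs `(a j, b j)` for which item `i` is truly good, while every other item of `S` is bad. -/
def highEvent (S : Finset (Fin n)) (g : Fin n → ℝ) (i : Fin n) : Set (Fin n → ℝ × ℝ) :=
  {w | (w i).1 ≤ 0 ∧ g i ≤ (w i).2 ∧ ∀ j ∈ S, j ≠ i → (w j).2 < g j}

/-- The observation for noise `a` and second copy `b`, as a function of the pairs `(a j, b j)`. -/
noncomputable def hardObs (S : Finset (Fin n)) (g : Fin n → ℝ) (w : Fin n → ℝ × ℝ) : Fin n → ℝ :=
  hardValue S g (fun j => (w j).2) + fun j => (w j).1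

/-- Exchange the two noises of item `i`. -/
def swapAt (i : Fin n) (w : Fin n → ℝ × ℝ) : Fin n → ℝ × ℝ :=
  fun j => (if j = i then Prod.swap else id) (w j)

theorem measurePreserving_swapAt [∀ i, IsProbabilityMeasure (A i)] (i : Fin n) :
    MeasurePreserving (swapAt i) (Measure.pi fun j => (A j).prod (A j))
      (Measure.pi fun j => (A j).prod (A j)) := by
  refine measurePreserving_pi (f := fun j => if j = i then Prod.swap else id) _ _ fun j => ?_
  by_cases h : j = i
  · simp only [h, if_true]
    exact Measure.measurePreserving_swap
  · simp only [h, if_false]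
    exact MeasurePreserving.id _

theorem swapAt_mem_highEvent (S : Finset (Fin n)) (g : Fin n → ℝ) (i : Fin n)
    (w : Fin n → ℝ × ℝ) : swapAt i w ∈ highEvent S g i ↔ w ∈ lowEvent S g i := by
  simp only [highEvent, lowEvent, swapAt, Set.mem_ofPred_eq, if_true, Prod.fst_swap, Prod.snd_swap]
  have : (∀ j ∈ S, j ≠ i → ((if j = i then Prod.swap else id) (w j)).2 < g j) ↔
      ∀ j ∈ S, j ≠ i → (w j).2 < g j := by
    refine forall₃_congr fun j _ hj => ?_
    simp [hj]
  rw [this]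
  tauto

/-- The observation depends on `(a i, b i)` only through `a i + b i` on the two events, so it is
the same before and after the exchange: no algorithm can tell the two situations apart. -/
theorem hardObs_swapAt {S : Finset (Fin n)} {g : Fin n → ℝ} {i : Fin n} (hi : i ∈ S)
    {w : Fin n → ℝ × ℝ} (hw : w ∈ lowEvent S g i) :
    hardObs S g (swapAt i w) = hardObs S g w := by
  obtain ⟨h1, h2, -⟩ := hw
  funext j
  by_cases hj : j = i
  · subst hj
    simp only [hardObs, hardValue, swapAt, Pi.add_apply, if_true, Prod.fst_swap, Prod.snd_swap]
    rw [if_pos hi, if_pos hi, if_neg (fun h => absurd h.2 (not_lt.2 h1)),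
      if_neg (fun h => absurd h.1 (not_lt.2 h2))]
    ring
  · simp [hardObs, hardValue, swapAt, hj]

theorem measurable_hardValue (S : Finset (Fin n)) (g : Fin n → ℝ) :
    Measurable (hardValue S g) := by
  refine measurable_pi_lambda _ fun i => ?_
  unfold hardValue
  by_cases hi : i ∈ S
  · simp only [hi, if_true]
    refine Measurable.sub_const (Measurable.ite ?_ measurable_const (measurable_pi_apply i)) _
    exact (measurableSet_lt measurable_const (measurable_pi_apply i)).inter
      (measurableSet_lt (measurable_pi_apply i) measurable_const)
  · simp only [hi, if_false]
    exact measurable_const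

theorem measurable_hardObs (S : Finset (Fin n)) (g : Fin n → ℝ) : Measurable (hardObs S g) :=
  ((measurable_hardValue S g).comp (measurable_pi_lambda _ fun j =>
    (measurable_pi_apply j).snd)).add (measurable_pi_lambda _ fun j => (measurable_pi_apply j).fst)

theorem measurableSet_lowEvent (S : Finset (Fin n)) (g : Fin n → ℝ) (i : Fin n) :
    MeasurableSet (lowEvent S g i) := by
  unfold lowEvent
  simp only [measurableSet_setOfPred]
  fun_prop

theorem measurableSet_highEvent (S : Finset (Fin n)) (g : Fin n → ℝ) (i : Fin n) :
    MeasurableSet (highEvent S g i) := by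
  unfold highEvent
  simp only [measurableSet_setOfPred]
  fun_prop

/-- Pointwise bound on the loss of the distribution `κ` of the picked item. On `lowEvent` the item
`i` has value at most `-g i / 2`, while `o` has value `0`; on `highEvent` it is the only item of
positive value, at least `g i / 2`. At most one `highEvent` occurs, and it excludes every
`lowEvent`. -/
theorem loss_lower_bound {S : Finset (Fin n)} {g : Fin n → ℝ} (hg : ∀ i ∈ S, 0 < g i)
    {o : Fin n} (ho : o ∉ S) (κ : Measure (Fin n)) (w : Fin n → ℝ × ℝ) :
    ∑ i ∈ S, ENNReal.ofReal (g i / 2) *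
        ((lowEvent S g i).indicator (fun _ => κ {i}) w
          + (highEvent S g i).indicator (fun _ => κ {i}ᶜ) w)
      ≤ ∑ k, κ {k} * ENNReal.ofReal ((⨆ j, hardValue S g (fun j => (w j).2) j)
          - hardValue S g (fun j => (w j).2) k) := by
  set v := hardValue S g (fun j => (w j).2) with hv
  have hM : ∀ k, v k ≤ ⨆ j, v j := le_ciSup (Set.finite_range v).bddAbove
  have hvS : ∀ k ∈ S, v k = (if 0 < (w k).2 ∧ (w k).2 < g k then 0 else (w k).2) - g k / 2 := by
    intro k hk
    simp [hv, hardValue, hk]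
  have hvo : v o = 0 := by simp [hv, hardValue, ho]
  have hbad : ∀ k ∈ S, (w k).2 < g k → v k ≤ - (g k / 2) := by
    intro k hk hlt
    rw [hvS k hk]
    split_ifs with h
    · linarith
    · have : (w k).2 ≤ 0 := by
        by_contra hcon
        exact h ⟨not_le.1 hcon, hlt⟩
      linarith
  by_cases hex : ∃ i ∈ S, w ∈ highEvent S g i
  · obtain ⟨i, hi, hw⟩ := hex
    have hlow : ∀ j ∈ S, w ∉ lowEvent S g j := by
      intro j hj hwj
      by_cases hji : j = i
      · subst hji
        have := hw.2.1.trans hwj.2.1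
        exact absurd (hg j hj) (not_lt.2 this)
      · exact absurd (hwj.2.2 i hi (Ne.symm hji)) (not_lt.2 hw.2.1)
    have hhigh : ∀ j ∈ S, j ≠ i → w ∉ highEvent S g j := by
      intro j hj hji hwj
      exact absurd (hwj.2.2 i hi (Ne.symm hji)) (not_lt.2 hw.2.1)
    rw [Finset.sum_eq_single_of_mem i hi (fun j hj hji => by
      rw [Set.indicator_of_notMem (hlow j hj), Set.indicator_of_notMem (hhigh j hj hji)]; simp)]
    rw [Set.indicator_of_notMem (hlow i hi), Set.indicator_of_mem hw, zero_add]
    have hcompl : κ {i}ᶜ = ∑ k ∈ Finset.univ.erase i, κ {k} := by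
      rw [sum_measure_singleton]
      congr 1
      ext k
      simp
    rw [hcompl, Finset.mul_sum]
    refine (Finset.sum_le_sum fun k hk => ?_).trans
      (Finset.sum_le_sum_of_subset (Finset.erase_subset i Finset.univ))
    rw [mul_comm]
    gcongr
    have hki := (Finset.mem_erase.1 hk).1
    have h1 : v i ≥ g i / 2 := by
      rw [hvS i hi, if_neg (fun h => absurd h.2 (not_lt.2 hw.2.1))]
      linarith [hw.2.1]
    have h2 : v k ≤ 0 := by
      by_cases hkS : k ∈ S
      · have := hbad k hkS (hw.2.2 k hkS hki)
        linarith [hg k hkS]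
      · simp [hv, hardValue, hkS]
    linarith [hM i]
  · push Not at hex
    refine (Finset.sum_le_sum fun i hi => ?_).trans
      (Finset.sum_le_sum_of_subset (Finset.subset_univ S))
    rw [Set.indicator_of_notMem (hex i hi), add_zero]
    by_cases hw : w ∈ lowEvent S g i
    · rw [Set.indicator_of_mem hw, mul_comm]
      gcongr
      have := hbad i hi (hw.2.1.trans_lt (hg i hi))
      linarith [hM o]
    · rw [Set.indicator_of_notMem hw]
      simp

/-- The average of the loss bound over the prior: the exchange of `a i` and `b i` turns `highEvent`
into `lowEvent` with the same observation, so the probabilities of picking and of not picking `i`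
add up to one there. -/
theorem sum_measure_lowEvent_le_regret [∀ i, IsProbabilityMeasure (A i)]
    {S : Finset (Fin n)} {g : Fin n → ℝ} (hg : ∀ i ∈ S, 0 < g i)
    {o : Fin n} (ho : o ∉ S) (alg : Algorithm n) [IsMarkovKernel alg] :
    ∑ i ∈ S, ENNReal.ofReal (g i / 2) *
      (Measure.pi fun j => (A j).prod (A j)) (lowEvent S g i) ≤ regret A alg := by
  set P := Measure.pi fun j => (A j).prod (A j) with hP
  have hQ : ∀ T : Set (Fin n), Measurable fun w => alg (hardObs S g w) T := fun T =>
    (Kernel.measurable_coe alg (MeasurableSet.of_discrete)).comp (measurable_hardObs S g)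
  have hpair : ∀ i ∈ S,
      P (lowEvent S g i) = ∫⁻ w, ((lowEvent S g i).indicator (fun w => alg (hardObs S g w) {i}) w
          + (highEvent S g i).indicator (fun w => alg (hardObs S g w) {i}ᶜ) w) ∂P := by
    intro i hi
    have hswap : ∫⁻ w, (highEvent S g i).indicator (fun w => alg (hardObs S g w) {i}ᶜ) w ∂P
        = ∫⁻ w, (lowEvent S g i).indicator (fun w => alg (hardObs S g w) {i}ᶜ) w ∂P := by
      rw [← (measurePreserving_swapAt (A := A) i).lintegral_comp
        ((hQ _).indicator (measurableSet_highEvent S g i))]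
      refine lintegral_congr fun w => ?_
      by_cases hw : w ∈ lowEvent S g i
      · rw [Set.indicator_of_mem ((swapAt_mem_highEvent S g i w).2 hw), Set.indicator_of_mem hw,
          hardObs_swapAt hi hw]
      · rw [Set.indicator_of_notMem (fun h => hw ((swapAt_mem_highEvent S g i w).1 h)),
          Set.indicator_of_notMem hw]
    rw [lintegral_add_left ((hQ _).indicator (measurableSet_lowEvent S g i)), hswap,
      ← lintegral_add_left ((hQ _).indicator (measurableSet_lowEvent S g i)),
      ← lintegral_indicator_one (measurableSet_lowEvent S g i)]
    refine lintegral_congr fun w => ?_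
    by_cases hw : w ∈ lowEvent S g i
    · simp only [Set.indicator_of_mem hw, Pi.one_apply]
      rw [prob_add_prob_compl (MeasurableSet.singleton i)]
    · simp [Set.indicator_of_notMem hw]
  have hterm : ∀ i, Measurable fun w =>
      ((lowEvent S g i).indicator (fun w => alg (hardObs S g w) {i}) w
          + (highEvent S g i).indicator (fun w => alg (hardObs S g w) {i}ᶜ) w) := fun i =>
    ((hQ _).indicator (measurableSet_lowEvent S g i)).add
      ((hQ _).indicator (measurableSet_highEvent S g i))
  set F : (Fin n → ℝ) × (Fin n → ℝ) → ℝ≥0∞ := fun p =>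
    ∑ k, alg (hardValue S g p.2 + p.1) {k} *
      ENNReal.ofReal ((⨆ j, hardValue S g p.2 j) - hardValue S g p.2 k) with hF
  have hvm : ∀ k, Measurable fun p : (Fin n → ℝ) × (Fin n → ℝ) => hardValue S g p.2 k := fun k =>
    (measurable_pi_apply k).comp ((measurable_hardValue S g).comp measurable_snd)
  have hFm : Measurable F := by
    refine Finset.measurable_sum _ fun k _ => Measurable.mul ?_ ?_
    · exact (Kernel.measurable_coe alg (MeasurableSet.singleton k)).comp
        (((measurable_hardValue S g).comp measurable_snd).add measurable_fst)
    · exact ((Measurable.iSup hvm).sub (hvm k)).ennreal_ofReal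
  calc ∑ i ∈ S, ENNReal.ofReal (g i / 2) * P (lowEvent S g i)
      = ∫⁻ w, ∑ i ∈ S, ENNReal.ofReal (g i / 2) *
          ((lowEvent S g i).indicator (fun w => alg (hardObs S g w) {i}) w
          + (highEvent S g i).indicator (fun w => alg (hardObs S g w) {i}ᶜ) w) ∂P := by
        rw [lintegral_finsetSum _ fun i _ => (hterm i).const_mul _]
        refine Finset.sum_congr rfl fun i hi => ?_
        rw [lintegral_const_mul _ (hterm i), ← hpair i hi]
    _ ≤ ∫⁻ w, F (MeasurableEquiv.arrowProdEquivProdArrow ℝ ℝ (Fin n) w) ∂P := by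
        refine lintegral_mono fun w => ?_
        exact loss_lower_bound hg ho (alg (hardObs S g w)) w
    _ = ∫⁻ p, F p ∂((Measure.pi A).prod (Measure.pi A)) :=
        (measurePreserving_arrowProdEquivProdArrow ℝ ℝ (Fin n) A A).lintegral_comp hFm
    _ = ∫⁻ b, ∫⁻ a, F (a, b) ∂Measure.pi A ∂Measure.pi A := lintegral_prod_symm' _ hFm
    _ ≤ ∫⁻ _, regret A alg ∂Measure.pi A := by
        refine lintegral_mono fun b => ?_
        rw [← ofReal_regretAt_eq_lintegral alg (hardValue S g b)]
        exact le_iSup (fun v => ENNReal.ofReal (regretAt A alg v)) _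
    _ = regret A alg := by simp

theorem one_sub_sum_le_prod_one_sub {ι : Type*} (T : Finset ι) (p : ι → ℝ)
    (h0 : ∀ i ∈ T, 0 ≤ p i) (h1 : ∀ i ∈ T, p i ≤ 1) : 1 - ∑ i ∈ T, p i ≤ ∏ i ∈ T, (1 - p i) := by
  classical
  induction T using Finset.induction_on with
  | empty => simp
  | insert a T ha ih =>
    rw [Finset.sum_insert ha, Finset.prod_insert ha]
    have hT := ih (fun i hi => h0 i (Finset.mem_insert_of_mem hi))
      (fun i hi => h1 i (Finset.mem_insert_of_mem hi))
    have ha0 := h0 a (Finset.mem_insert_self a T)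
    have ha1 := h1 a (Finset.mem_insert_self a T)
    have hle : ∏ i ∈ T, (1 - p i) ≤ 1 := Finset.prod_le_one
      (fun i hi => sub_nonneg.2 (h1 i (Finset.mem_insert_of_mem hi)))
      (fun i hi => by linarith [h0 i (Finset.mem_insert_of_mem hi)])
    nlinarith

/-- `lowEvent` is a box, so that its measure is a product. -/
theorem le_measureReal_lowEvent [∀ i, IsProbabilityMeasure (A i)]
    {S : Finset (Fin n)} {g : Fin n → ℝ} {i : Fin n} (hi : i ∈ S)
    (hhalf : 1 / 2 ≤ (A i).real (Set.Iic 0)) :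
    (A i).real (Set.Ici (g i)) * (1 / 2) * (1 - ∑ j ∈ S, (A j).real (Set.Ici (g j))) ≤
      (Measure.pi fun j => (A j).prod (A j)).real (lowEvent S g i) := by
  have hset : lowEvent S g i = Set.univ.pi fun j =>
      if j = i then Set.Ici (g i) ×ˢ Set.Iic 0
      else if j ∈ S then Set.univ ×ˢ Set.Iio (g j) else Set.univ := by
    ext w
    simp only [lowEvent, Set.mem_ofPred_eq, Set.mem_pi, Set.mem_univ, true_implies]
    constructor
    · rintro ⟨h1, h2, h3⟩ j
      split_ifs with hj hjS
      · subst hj; exact ⟨h1, h2⟩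
      · exact ⟨trivial, h3 j hjS hj⟩
      · trivial
    · intro h
      have hii := h i
      rw [if_pos rfl] at hii
      refine ⟨hii.1, hii.2, fun j hjS hj => ?_⟩
      have hj' := h j
      rw [if_neg hj, if_pos hjS] at hj'
      exact hj'.2
  have hprod : (Measure.pi fun j => (A j).prod (A j)).real (lowEvent S g i) =
      (A i).real (Set.Ici (g i)) * (A i).real (Set.Iic 0) *
        ∏ j ∈ S.erase i, (1 - (A j).real (Set.Ici (g j))) := by
    rw [hset, measureReal_def, Measure.pi_pi, ENNReal.toReal_prod,
      ← Finset.mul_prod_erase _ _ (Finset.mem_univ i), if_pos rfl, Measure.prod_prod,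
      ENNReal.toReal_mul]
    congr 1
    refine (Finset.prod_subset_one_on_sdiff (Finset.erase_subset_erase i (Finset.subset_univ S))
      ?_ ?_).symm
    · intro j hj
      simp only [Finset.mem_sdiff, Finset.mem_erase, Finset.mem_univ, and_true, not_and] at hj
      rw [if_neg hj.1, if_neg (hj.2 hj.1)]
      simp
    · intro j hj
      rw [Finset.mem_erase] at hj
      rw [if_neg hj.1, if_pos hj.2, Measure.prod_prod, measure_univ, one_mul,
        ← probReal_compl_eq_one_sub measurableSet_Ici, Set.compl_Ici, measureReal_def]
  rw [hprod]
  have h1 := one_sub_sum_le_prod_one_sub (S.erase i) (fun j => (A j).real (Set.Ici (g j)))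
    (fun _ _ => measureReal_nonneg) (fun _ _ => measureReal_le_one)
  have h2 : ∑ j ∈ S.erase i, (A j).real (Set.Ici (g j)) ≤ ∑ j ∈ S, (A j).real (Set.Ici (g j)) :=
    Finset.sum_le_sum_of_subset_of_nonneg (Finset.erase_subset i S)
      fun _ _ _ => measureReal_nonneg
  have h3 : 0 ≤ ∏ j ∈ S.erase i, (1 - (A j).real (Set.Ici (g j))) :=
    Finset.prod_nonneg fun j _ => sub_nonneg.2 measureReal_le_one
  have h4 : 0 ≤ (A i).real (Set.Ici (g i)) := measureReal_nonneg
  calc _ ≤ (A i).real (Set.Ici (g i)) * (1 / 2) *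
        ∏ j ∈ S.erase i, (1 - (A j).real (Set.Ici (g j))) := by
        gcongr; linarith
    _ ≤ _ := by gcongr

/-- The lower bound on the regret of an arbitrary algorithm: any family `S` of items that leaves out
at least one item `o`, with any positive scales `g i`, forces a regret of order
`∑ i ∈ S, g i * Pr[a i ≥ g i]`, as long as the sum of these probabilities stays away from `1`. -/
theorem sum_mul_tail_le_of_regret_le [∀ i, IsProbabilityMeasure (A i)]
    (hhalf : ∀ i, 1 / 2 ≤ (A i).real (Set.Iic 0))
    {S : Finset (Fin n)} {g : Fin n → ℝ} (hg : ∀ i ∈ S, 0 < g i)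
    {o : Fin n} (ho : o ∉ S) {alg : Algorithm n} [IsMarkovKernel alg] {Ω : ℝ} (hΩ : 0 ≤ Ω)
    (hreg : regret A alg ≤ ENNReal.ofReal Ω) :
    (∑ i ∈ S, g i * (A i).real (Set.Ici (g i))) *
      (1 - ∑ j ∈ S, (A j).real (Set.Ici (g j))) ≤ 4 * Ω := by
  have h := (sum_measure_lowEvent_le_regret hg ho alg).trans hreg
  have heq : ∑ i ∈ S, ENNReal.ofReal (g i / 2) *
      (Measure.pi fun j => (A j).prod (A j)) (lowEvent S g i) =
      ENNReal.ofReal (∑ i ∈ S, g i / 2 *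
        (Measure.pi fun j => (A j).prod (A j)).real (lowEvent S g i)) := by
    rw [ENNReal.ofReal_sum_of_nonneg fun i hi =>
      mul_nonneg (half_pos (hg i hi)).le measureReal_nonneg]
    refine Finset.sum_congr rfl fun i hi => ?_
    rw [ENNReal.ofReal_mul (half_pos (hg i hi)).le, ofReal_measureReal]
  rw [heq, ENNReal.ofReal_le_ofReal_iff hΩ] at h
  have h2 : ∑ i ∈ S, g i / 2 * ((A i).real (Set.Ici (g i)) * (1 / 2) *
      (1 - ∑ j ∈ S, (A j).real (Set.Ici (g j)))) ≤ Ω := by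
    refine (Finset.sum_le_sum fun i hi => ?_).trans h
    exact mul_le_mul_of_nonneg_left (le_measureReal_lowEvent hi (hhalf i)) (half_pos (hg i hi)).le
  calc _ = 4 * ∑ i ∈ S, g i / 2 * ((A i).real (Set.Ici (g i)) * (1 / 2) *
      (1 - ∑ j ∈ S, (A j).real (Set.Ici (g j)))) := by
        rw [Finset.sum_mul, Finset.mul_sum]
        exact Finset.sum_congr rfl fun i _ => by ring
    _ ≤ _ := by linarith

/-! ### Tails of symmetric noises -/

theorem IsSymmetric.measure_Ici {D : Measure ℝ} [IsProbabilityMeasure D] (hD : IsSymmetric D)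
    (x : ℝ) : D (Set.Ici x) = D (Set.Iic (-x)) := by
  rw [← Set.compl_Iio, ← Set.compl_Ioi, prob_compl_eq_one_sub measurableSet_Iio,
    prob_compl_eq_one_sub measurableSet_Ioi, hD (-x), neg_neg]

theorem IsSymmetric.half_le_measureReal_Iic_zero {D : Measure ℝ} [IsProbabilityMeasure D]
    (hD : IsSymmetric D) : 1 / 2 ≤ D.real (Set.Iic 0) := by
  have h1 : D.real (Set.Ioi 0) = D.real (Set.Iio 0) := by
    rw [measureReal_def, hD 0, neg_zero, measureReal_def]
  have h2 : D.real (Set.Iio 0) ≤ D.real (Set.Iic 0) := measureReal_mono Set.Iio_subset_Iic_self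
  have h3 : D.real (Set.Ioi 0) = 1 - D.real (Set.Iic 0) := by
    rw [← Set.compl_Iic, probReal_compl_eq_one_sub measurableSet_Iic]
  linarith

theorem IsSymmetric.measureReal_Ici_le_half {D : Measure ℝ} [IsProbabilityMeasure D]
    (hD : IsSymmetric D) {t : ℝ} (ht : 0 < t) : D.real (Set.Ici t) ≤ 1 / 2 := by
  have h1 : D.real (Set.Ici t) ≤ D.real (Set.Ioi 0) :=
    measureReal_mono (Set.Ici_subset_Ioi.2 ht)
  have h3 : D.real (Set.Ioi 0) = 1 - D.real (Set.Iic 0) := by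
    rw [← Set.compl_Iic, probReal_compl_eq_one_sub measurableSet_Iic]
  linarith [hD.half_le_measureReal_Iic_zero]

theorem IsSymmetric.measureReal_le_abs_le {D : Measure ℝ} [IsProbabilityMeasure D]
    (hD : IsSymmetric D) (t : ℝ) : D.real {x | t ≤ |x|} ≤ 2 * D.real (Set.Ici t) := by
  have hset : {x : ℝ | t ≤ |x|} = Set.Ici t ∪ Set.Iic (-t) := by
    ext x
    simp only [Set.mem_ofPred_eq, Set.mem_union, Set.mem_Ici, Set.mem_Iic, le_abs]
    exact or_congr Iff.rfl le_neg
  rw [hset]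
  refine (measureReal_union_le _ _).trans (le_of_eq ?_)
  rw [measureReal_def, measureReal_def, hD.measure_Ici]
  ring

/-- Adding terms of size at most `1 / 2` one at a time, the sum cannot jump over `(1 / 4, 3 / 4]`. -/
theorem exists_subset_sum_between {ι : Type*} [DecidableEq ι] (S : Finset ι) (p : ι → ℝ)
    (hp : ∀ i ∈ S, p i ≤ 1 / 2) (hS : 1 / 4 < ∑ i ∈ S, p i) :
    ∃ T ⊆ S, 1 / 4 < ∑ i ∈ T, p i ∧ ∑ i ∈ T, p i ≤ 3 / 4 := by
  induction S using Finset.induction_on with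
  | empty => norm_num at hS
  | insert a S ha ih =>
    by_cases h : 1 / 4 < ∑ i ∈ S, p i
    · obtain ⟨T, hT, h'⟩ := ih (fun i hi => hp i (Finset.mem_insert_of_mem hi)) h
      exact ⟨T, hT.trans (Finset.subset_insert a S), h'⟩
    · refine ⟨insert a S, subset_rfl, hS, ?_⟩
      rw [Finset.sum_insert ha]
      linarith [hp a (Finset.mem_insert_self a S)]

/-- The tail of a single noise, from the lower bound with one uncertain item. -/
theorem mul_tail_le_of_regret_le [∀ i, IsProbabilityMeasure (A i)]
    (hsymm : ∀ i, IsSymmetric (A i)) {alg : Algorithm n} [IsMarkovKernel alg] {Ω : ℝ} (hΩ : 0 < Ω)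
    (hreg : regret A alg ≤ ENNReal.ofReal Ω)
    {j o : Fin n} (ho : o ≠ j) {t : ℝ} (ht : 0 < t) :
    t * (A j).real (Set.Ici t) ≤ 8 * Ω := by
  have h := sum_mul_tail_le_of_regret_le (fun i => (hsymm i).half_le_measureReal_Iic_zero)
    (S := {j}) (g := fun _ => t) (fun _ _ => ht) (o := o) (by simpa using ho) hΩ.le hreg
  simp only [Finset.sum_singleton] at h
  have h1 := (hsymm j).measureReal_Ici_le_half ht
  have h2 : 0 ≤ t * (A j).real (Set.Ici t) := mul_nonneg ht.le measureReal_nonneg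
  nlinarith

/-- Among items with thresholds above `64 Ω`, few noises reach their threshold: otherwise a
subfamily with total probability of order one would force a regret larger than `Ω`. -/
theorem sum_mul_tail_le_of_large [∀ i, IsProbabilityMeasure (A i)]
    (hsymm : ∀ i, IsSymmetric (A i)) {alg : Algorithm n} [IsMarkovKernel alg] {Ω : ℝ} (hΩ : 0 < Ω)
    (hreg : regret A alg ≤ ENNReal.ofReal Ω)
    {S : Finset (Fin n)} {u : Fin n → ℝ}
    (hu : ∀ i ∈ S, 64 * Ω < u i) {o : Fin n} (ho : o ∉ S) :
    ∑ i ∈ S, u i * (A i).real (Set.Ici (u i)) ≤ 8 * Ω := by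
  have hu0 : ∀ i ∈ S, 0 < u i := fun i hi => by linarith [hu i hi]
  have hsmall : ∑ i ∈ S, (A i).real (Set.Ici (u i)) ≤ 1 / 4 := by
    by_contra! hcon
    obtain ⟨T, hTS, hT1, hT2⟩ := exists_subset_sum_between S
      (fun i => (A i).real (Set.Ici (u i)))
      (fun i hi => (hsymm i).measureReal_Ici_le_half (hu0 i hi)) hcon
    have h := sum_mul_tail_le_of_regret_le (fun i => (hsymm i).half_le_measureReal_Iic_zero)
      (S := T) (g := u) (fun i hi => hu0 i (hTS hi)) (o := o) (fun h => ho (hTS h)) hΩ.le hreg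
    have h2 : 64 * Ω * ∑ i ∈ T, (A i).real (Set.Ici (u i))
        ≤ ∑ i ∈ T, u i * (A i).real (Set.Ici (u i)) := by
      rw [Finset.mul_sum]
      exact Finset.sum_le_sum fun i hi =>
        mul_le_mul_of_nonneg_right (hu i (hTS hi)).le measureReal_nonneg
    have h3 : 16 * Ω < ∑ i ∈ T, u i * (A i).real (Set.Ici (u i)) := by nlinarith
    have h4 := mul_le_mul_of_nonneg_left (by linarith :
      1 / 4 ≤ 1 - ∑ i ∈ T, (A i).real (Set.Ici (u i))) (by linarith :
      0 ≤ ∑ i ∈ T, u i * (A i).real (Set.Ici (u i)))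
    linarith
  have h := sum_mul_tail_le_of_regret_le (fun i => (hsymm i).half_le_measureReal_Iic_zero)
    hu0 ho hΩ.le hreg
  have h2 : 0 ≤ ∑ i ∈ S, u i * (A i).real (Set.Ici (u i)) := Finset.sum_nonneg fun i hi =>
    mul_nonneg (hu0 i hi).le measureReal_nonneg
  nlinarith

/-! ### The regret of the greedy algorithm -/

/-- The smaller of two independent noises has a tail of order `R ^ 2 / t ^ 2`, hence a finite mean,
although a single noise with tail `R / t` may have none. -/
theorem lintegral_min_abs_le [∀ i, IsProbabilityMeasure (A i)] {m k : Fin n} (hmk : m ≠ k)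
    {R : ℝ} (hR : 0 < R) (hm : ∀ t, 0 < t → t * (A m).real {x | t ≤ |x|} ≤ R)
    (hk : ∀ t, 0 < t → t * (A k).real {x | t ≤ |x|} ≤ R) :
    ∫⁻ a, ENNReal.ofReal (min |a m| |a k|) ∂Measure.pi A ≤ ENNReal.ofReal (2 * R) := by
  have hrect : ∀ t, Measure.pi A {a | t ≤ min |a m| |a k|} =
      (A m) {x | t ≤ |x|} * (A k) {x | t ≤ |x|} := by
    intro t
    have hset : {a : Fin n → ℝ | t ≤ min |a m| |a k|} = Set.univ.pi fun j =>
        if j ∈ ({m, k} : Finset (Fin n)) then {x : ℝ | t ≤ |x|} else Set.univ := by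
      ext a
      simp only [Set.mem_ofPred_eq, le_min_iff, Set.mem_pi, Set.mem_univ, true_implies]
      constructor
      · rintro ⟨h1, h2⟩ j
        split_ifs with hj
        · rcases Finset.mem_insert.1 hj with rfl | hj
          · exact h1
          · rw [Finset.mem_singleton] at hj
            subst hj
            exact h2
        · trivial
      · intro h
        have h1 := h m
        have h2 := h k
        rw [if_pos (by simp)] at h1 h2
        exact ⟨h1, h2⟩
    rw [hset, Measure.pi_pi, ← Finset.prod_pair hmk (f := fun j => A j {x | t ≤ |x|})]
    refine (Finset.prod_subset_one_on_sdiff (Finset.subset_univ _) ?_ ?_).symm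
    · intro j hj
      rw [if_neg (Finset.mem_sdiff.1 hj).2, measure_univ]
    · intro j hj
      rw [if_pos hj]
  have htail : ∀ t, 0 < t → Measure.pi A {a | t ≤ min |a m| |a k|} ≤
      ENNReal.ofReal (R ^ 2 * t ^ (-2 : ℝ)) := by
    intro t ht
    rw [hrect, ← ofReal_measureReal, ← ofReal_measureReal (μ := A k),
      ← ENNReal.ofReal_mul measureReal_nonneg]
    refine ENNReal.ofReal_le_ofReal ?_
    have h1 : (A m).real {x | t ≤ |x|} ≤ R / t := by
      rw [le_div_iff₀ ht, mul_comm]; exact hm t ht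
    have h2 : (A k).real {x | t ≤ |x|} ≤ R / t := by
      rw [le_div_iff₀ ht, mul_comm]; exact hk t ht
    calc _ ≤ R / t * (R / t) := mul_le_mul h1 h2 measureReal_nonneg (by positivity)
      _ = R ^ 2 * t ^ (-2 : ℝ) := by
        rw [Real.rpow_neg ht.le, Real.rpow_two]
        field_simp
  have hmeas : Measurable fun a : Fin n → ℝ => min |a m| |a k| := by fun_prop
  rw [lintegral_eq_lintegral_meas_le _
    (Filter.Eventually.of_forall fun a => le_min (abs_nonneg _) (abs_nonneg _)) hmeas.aemeasurable,
    ← Set.Ioc_union_Ioi_eq_Ioi hR.le, lintegral_union measurableSet_Ioi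
      (Set.Ioc_disjoint_Ioi le_rfl), two_mul, ENNReal.ofReal_add hR.le hR.le]
  refine add_le_add ?_ ?_
  · calc _ ≤ ∫⁻ _ in Set.Ioc 0 R, (1 : ℝ≥0∞) := lintegral_mono fun _ => prob_le_one
      _ = ENNReal.ofReal R := by simp
  · calc _ ≤ ∫⁻ t in Set.Ioi R, ENNReal.ofReal (R ^ 2 * t ^ (-2 : ℝ)) :=
          setLIntegral_mono' measurableSet_Ioi fun t ht => htail t (hR.trans ht)
      _ = ENNReal.ofReal (∫ t in Set.Ioi R, R ^ 2 * t ^ (-2 : ℝ)) := by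
          refine (ofReal_integral_eq_lintegral_ofReal
            ((integrableOn_Ioi_rpow_of_lt (by norm_num) hR).const_mul _) ?_).symm
          filter_upwards [ae_restrict_mem measurableSet_Ioi] with t ht
          have : 0 < t := hR.trans ht
          positivity
      _ = ENNReal.ofReal R := by
          congr 1
          rw [integral_const_mul, integral_Ioi_rpow_of_lt (by norm_num) hR]
          norm_num
          rw [Real.rpow_neg_one]
          field_simp

theorem pi_eval_mem [∀ i, IsProbabilityMeasure (A i)] (j : Fin n) {B : Set ℝ}
    (hB : MeasurableSet B) : Measure.pi A {a | a j ∈ B} = A j B :=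
  (measurePreserving_eval A j).measure_preimage hB.nullMeasurableSet

/-- If the item `i` has the highest observation, then its gap to the best item `m` is large only
when its own noise is large, or when the noises of `m` and of the second best item `k` are both
very negative, or when the gap of `i` is comparable to that of `k` and `m` is underestimated. -/
theorem gap_le_of_forall_obs_le {v a : Fin n → ℝ} {m k i : Fin n}
    (hm : ∀ j, v j ≤ v m) (hk : ∀ j, j ≠ m → v j ≤ v k) (hi : ∀ j, v j + a j ≤ v i + a i)
    (him : i ≠ m) :
    (v m - v i) / 4 ≤ a i ∨ v m - v i ≤ 4 * min |a m| |a k| ∨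
      (v m - v i ≤ 2 * (v m - v k) ∧ a m ≤ -((v m - v k) / 2)) := by
  by_contra! hcon
  obtain ⟨h1, h2, h3⟩ := hcon
  have hmi := hi m
  have him' := hm i
  have hki := hi k
  have hkv := hk i him
  by_cases hc : v m - v i ≤ 2 * (v m - v k)
  · have := h3 hc
    linarith
  · push Not at hc
    have h4 : (v m - v i) / 4 ≤ |a m| := le_abs.2 (Or.inr (by linarith))
    have h5 : (v m - v i) / 4 ≤ |a k| := le_abs.2 (Or.inr (by linarith))
    linarith [le_min h4 h5]

/-- An average over a distribution carried by `T` only sees the values on `T`. -/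
theorem sum_mul_le_of_measure_eq_one {κ : Measure (Fin n)} [IsProbabilityMeasure κ]
    {T : Set (Fin n)} (hT : κ T = 1) {c : Fin n → ℝ≥0∞} {B : ℝ≥0∞} (hc : ∀ i ∈ T, c i ≤ B) :
    ∑ i, κ {i} * c i ≤ B := by
  have hzero : κ Tᶜ = 0 := (prob_compl_eq_zero_iff MeasurableSet.of_discrete).2 hT
  calc ∑ i, κ {i} * c i ≤ ∑ i, κ {i} * B := by
        refine Finset.sum_le_sum fun i _ => ?_
        by_cases hi : i ∈ T
        · gcongr
          exact hc i hi
        · rw [measure_mono_null (Set.singleton_subset_iff.2 hi) hzero]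
          simp
    _ = B := by
        rw [← Finset.sum_mul, sum_measure_singleton]
        simp

/-- The loss of a greedy algorithm, on a given noise vector, is at most the sum of four terms: a
constant `256 Ω`, the gaps above it of the items whose noise is large, the smaller of the noises of
the two best items, and the gap between the two best items if the best one is underestimated. -/
theorem greedy_loss_le {alg : Algorithm n} [IsMarkovKernel alg] (halg : IsGreedy alg)
    {v a : Fin n → ℝ} {m k : Fin n} (hm : ∀ j, v j ≤ v m) (hk : ∀ j, j ≠ m → v j ≤ v k) (Ω : ℝ)
    {S : Finset (Fin n)} (hS : ∀ i, i ≠ m → 64 * Ω < (v m - v i) / 4 → i ∈ S) :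
    ∑ i, alg (v + a) {i} * ENNReal.ofReal (v m - v i) ≤
      ENNReal.ofReal (256 * Ω)
      + ∑ i ∈ S, {a : Fin n → ℝ | a i ∈ Set.Ici ((v m - v i) / 4)}.indicator
          (fun _ => ENNReal.ofReal (v m - v i)) a
      + 4 * ENNReal.ofReal (min |a m| |a k|)
      + {a : Fin n → ℝ | a m ∈ Set.Iic (-((v m - v k) / 2))}.indicator
          (fun _ => ENNReal.ofReal (2 * (v m - v k))) a := by
  refine sum_mul_le_of_measure_eq_one (halg (v + a)) fun i hi => ?_
  by_cases him : i = m
  · simp [him]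
  rcases gap_le_of_forall_obs_le hm hk hi him with h | h | ⟨h, h'⟩
  · refine le_trans ?_ (le_trans le_self_add le_self_add)
    by_cases hc : 64 * Ω < (v m - v i) / 4
    · refine le_trans (le_trans ?_ (Finset.single_le_sum (fun _ _ => zero_le)
        (hS i him hc))) le_add_self
      rw [Set.indicator_of_mem (show a ∈ {a : Fin n → ℝ | a i ∈ Set.Ici ((v m - v i) / 4)} from h)]
    · exact le_trans (ENNReal.ofReal_le_ofReal (by linarith)) le_self_add
  · refine le_trans (le_trans ?_ le_add_self) le_self_add
    rw [show (4 : ℝ≥0∞) = ENNReal.ofReal 4 by simp, ← ENNReal.ofReal_mul (by norm_num)]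
    exact ENNReal.ofReal_le_ofReal h
  · refine le_trans ?_ le_add_self
    rw [Set.indicator_of_mem
      (show a ∈ {a : Fin n → ℝ | a m ∈ Set.Iic (-((v m - v k) / 2))} from h')]
    exact ENNReal.ofReal_le_ofReal h

theorem greedy_regretAt_le [∀ i, IsProbabilityMeasure (A i)] (hn : 0 < n)
    (hsymm : ∀ i, IsSymmetric (A i)) {alg alg' : Algorithm n} [IsMarkovKernel alg]
    [IsMarkovKernel alg'] (halg : IsGreedy alg) {Ω : ℝ} (hΩ : 0 < Ω)
    (hreg : regret A alg' ≤ ENNReal.ofReal Ω) (v : Fin n → ℝ) :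
    ENNReal.ofReal (regretAt A alg v) ≤ ENNReal.ofReal (448 * Ω) := by
  have : Nonempty (Fin n) := ⟨⟨0, hn⟩⟩
  obtain ⟨m, hm⟩ := Finite.exists_max v
  have hsup : ⨆ j, v j = v m :=
    le_antisymm (ciSup_le hm) (le_ciSup (Set.finite_range v).bddAbove m)
  rw [ofReal_regretAt_eq_lintegral, hsup]
  by_cases hone : ∀ i, i = m
  · have hz : ∀ i, v m - v i = 0 := fun i => by rw [hone i, sub_self]
    simp [hz]
  push Not at hone
  obtain ⟨k, hkm, hk⟩ : ∃ k, k ≠ m ∧ ∀ j, j ≠ m → v j ≤ v k := by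
    obtain ⟨i₀, hi₀⟩ := hone
    obtain ⟨k, hk, hmax⟩ := Finset.exists_max_image (Finset.univ.erase m) v
      ⟨i₀, Finset.mem_erase.2 ⟨hi₀, Finset.mem_univ _⟩⟩
    exact ⟨k, (Finset.mem_erase.1 hk).1, fun j hj =>
      hmax j (Finset.mem_erase.2 ⟨hj, Finset.mem_univ _⟩)⟩
  set S : Finset (Fin n) := Finset.univ.filter fun i => i ≠ m ∧ 64 * Ω < (v m - v i) / 4 with hSdef
  have hS : ∀ i ∈ S, 64 * Ω < (v m - v i) / 4 := fun i hi => (Finset.mem_filter.1 hi).2.2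
  have hmS : m ∉ S := fun h => (Finset.mem_filter.1 h).2.1 rfl
  have hev : ∀ (j : Fin n) {B : Set ℝ}, MeasurableSet B →
      MeasurableSet {a : Fin n → ℝ | a j ∈ B} := fun j B hB => measurable_pi_apply j hB
  have hlarge : ∑ i ∈ S, ∫⁻ a, {a : Fin n → ℝ | a i ∈ Set.Ici ((v m - v i) / 4)}.indicator
      (fun _ => ENNReal.ofReal (v m - v i)) a ∂Measure.pi A ≤ ENNReal.ofReal (32 * Ω) := by
    have heq : ∀ i ∈ S, ∫⁻ a, {a : Fin n → ℝ | a i ∈ Set.Ici ((v m - v i) / 4)}.indicator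
      (fun _ => ENNReal.ofReal (v m - v i)) a ∂Measure.pi A =
        ENNReal.ofReal ((v m - v i) * (A i).real (Set.Ici ((v m - v i) / 4))) := by
      intro i _
      rw [lintegral_indicator_const (hev i measurableSet_Ici), pi_eval_mem i measurableSet_Ici,
        ENNReal.ofReal_mul (sub_nonneg.2 (hm i)), ofReal_measureReal]
    rw [Finset.sum_congr rfl heq, ← ENNReal.ofReal_sum_of_nonneg fun i _ =>
      mul_nonneg (sub_nonneg.2 (hm i)) measureReal_nonneg]
    refine ENNReal.ofReal_le_ofReal ?_
    have h := sum_mul_tail_le_of_large hsymm hΩ hreg hS hmS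
    calc _ = 4 * ∑ i ∈ S, (v m - v i) / 4 * (A i).real (Set.Ici ((v m - v i) / 4)) := by
          rw [Finset.mul_sum]
          exact Finset.sum_congr rfl fun i _ => by ring
      _ ≤ _ := by linarith
  have habs : ∀ j o : Fin n, o ≠ j → ∀ t, 0 < t → t * (A j).real {x | t ≤ |x|} ≤ 16 * Ω := by
    intro j o hoj t ht
    have h1 := mul_tail_le_of_regret_le hsymm hΩ hreg hoj ht
    have h2 := mul_le_mul_of_nonneg_left ((hsymm j).measureReal_le_abs_le t) ht.le
    linarith
  have hmin := lintegral_min_abs_le (A := A) (Ne.symm hkm) (by positivity : 0 < 16 * Ω)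
    (habs m k hkm) (habs k m (Ne.symm hkm))
  have hunder : ∫⁻ a, {a : Fin n → ℝ | a m ∈ Set.Iic (-((v m - v k) / 2))}.indicator
      (fun _ => ENNReal.ofReal (2 * (v m - v k))) a ∂Measure.pi A ≤ ENNReal.ofReal (32 * Ω) := by
    rw [lintegral_indicator_const (hev m measurableSet_Iic), pi_eval_mem m measurableSet_Iic,
      ← (hsymm m).measure_Ici, ← ofReal_measureReal, ← ENNReal.ofReal_mul
        (mul_nonneg zero_le_two (sub_nonneg.2 (hm k)))]
    refine ENNReal.ofReal_le_ofReal ?_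
    rcases (hm k).eq_or_lt with h | h
    · rw [h, sub_self]
      simp [hΩ.le]
    · have := mul_tail_le_of_regret_le hsymm hΩ hreg hkm (t := (v m - v k) / 2) (by linarith)
      linarith
  have hminm : Measurable fun a : Fin n → ℝ => ENNReal.ofReal (min |a m| |a k|) := by fun_prop
  calc _ ≤ ∫⁻ a, (ENNReal.ofReal (256 * Ω)
      + ∑ i ∈ S, {a : Fin n → ℝ | a i ∈ Set.Ici ((v m - v i) / 4)}.indicator
          (fun _ => ENNReal.ofReal (v m - v i)) a
      + 4 * ENNReal.ofReal (min |a m| |a k|)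
      + {a : Fin n → ℝ | a m ∈ Set.Iic (-((v m - v k) / 2))}.indicator
          (fun _ => ENNReal.ofReal (2 * (v m - v k))) a) ∂Measure.pi A :=
        lintegral_mono fun a => greedy_loss_le halg hm hk Ω fun i him hi =>
          Finset.mem_filter.2 ⟨Finset.mem_univ i, him, hi⟩
    _ = ENNReal.ofReal (256 * Ω)
      + ∑ i ∈ S, ∫⁻ a, {a : Fin n → ℝ | a i ∈ Set.Ici ((v m - v i) / 4)}.indicator
          (fun _ => ENNReal.ofReal (v m - v i)) a ∂Measure.pi A
      + 4 * ∫⁻ a, ENNReal.ofReal (min |a m| |a k|) ∂Measure.pi A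
      + ∫⁻ a, {a : Fin n → ℝ | a m ∈ Set.Iic (-((v m - v k) / 2))}.indicator
          (fun _ => ENNReal.ofReal (2 * (v m - v k))) a ∂Measure.pi A := by
        rw [lintegral_add_right _ (measurable_const.indicator (hev m measurableSet_Iic)),
          lintegral_add_right _ (hminm.const_mul 4),
          lintegral_add_left measurable_const, lintegral_const_mul 4 hminm,
          lintegral_finsetSum _ fun i _ => measurable_const.indicator (hev i measurableSet_Ici)]
        simp
    _ ≤ ENNReal.ofReal (256 * Ω) + ENNReal.ofReal (32 * Ω)
        + ENNReal.ofReal 4 * ENNReal.ofReal (2 * (16 * Ω)) + ENNReal.ofReal (32 * Ω) := by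
        gcongr
        simp
    _ = ENNReal.ofReal (448 * Ω) := by
        rw [← ENNReal.ofReal_mul (by norm_num), ← ENNReal.ofReal_add (by positivity) (by positivity),
          ← ENNReal.ofReal_add (by positivity) (by positivity),
          ← ENNReal.ofReal_add (by positivity) (by positivity)]
        congr 1
        ring

theorem greedy_regret_le [∀ i, IsProbabilityMeasure (A i)] (hn : 0 < n)
    (hsymm : ∀ i, IsSymmetric (A i)) {alg : Algorithm n} [IsMarkovKernel alg]
    (halg : IsGreedy alg) : regret A alg ≤ 448 * optRegret A := by
  have hkey : ∀ alg' : Algorithm n, IsMarkovKernel alg' → regret A alg ≤ 448 * regret A alg' := by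
    intro alg' _
    rcases eq_or_ne (regret A alg') ∞ with htop | htop
    · rw [htop, ENNReal.mul_top (by norm_num)]
      exact le_top
    refine ENNReal.le_of_forall_pos_le_add fun ε hε _ => ?_
    -- `Ω` is kept positive, since the optimal regret can vanish
    set Ω : ℝ := (regret A alg').toReal + ε / 448 with hΩdef
    have hΩ : 0 < Ω := by positivity
    have hle : regret A alg' ≤ ENNReal.ofReal Ω :=
      ENNReal.le_ofReal_iff_toReal_le htop hΩ.le |>.2 (by
        rw [hΩdef]
        have : (0 : ℝ) ≤ ε / 448 := by positivity
        linarith)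
    calc regret A alg ≤ ENNReal.ofReal (448 * Ω) :=
          iSup_le fun v => greedy_regretAt_le hn hsymm halg hΩ hle v
      _ = 448 * regret A alg' + ε := by
          rw [hΩdef, mul_add, mul_div_cancel₀ _ (by norm_num : (448 : ℝ) ≠ 0),
            ENNReal.ofReal_add (by positivity) (by positivity), ENNReal.ofReal_mul (by norm_num),
            ENNReal.ofReal_toReal htop, ENNReal.ofReal_coe_nnreal]
          simp
  unfold optRegret
  rw [ENNReal.mul_iInf_of_ne (by norm_num) (by norm_num)]
  refine le_iInf fun alg' => ?_
  rw [ENNReal.mul_iInf_of_ne (by norm_num) (by norm_num)]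
  exact le_iInf fun h => hkey alg' h

/-! ### The threshold of a symmetric noise -/

/-- The first of the two suprema in `thresholdCost`: the worst case over positive values. -/
noncomputable def lowerCost (D : Measure ℝ) (t : ℝ) : ℝ≥0∞ :=
  ⨆ (v : ℝ) (_ : 0 < v), D (Set.Iic (t - v)) * ENNReal.ofReal v

theorem lowerCost_mono (D : Measure ℝ) : Monotone (lowerCost D) := fun s t hst =>
  iSup₂_mono fun v _ => mul_le_mul_left (measure_mono (Set.Iic_subset_Iic.2 (by linarith))) _

/-- By symmetry, the second supremum in `thresholdCost D t` is `lowerCost D (-t)`. -/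
theorem IsSymmetric.thresholdCost_eq {D : Measure ℝ} [IsProbabilityMeasure D]
    (hD : IsSymmetric D) (t : ℝ) : thresholdCost D t = lowerCost D |t| := by
  have h2 : (⨆ (v : ℝ) (_ : v < 0), D (Set.Ici (t - v)) * ENNReal.ofReal (-v))
      = lowerCost D (-t) := by
    unfold lowerCost
    refine (Equiv.neg ℝ).iSup_congr fun v => ?_
    simp only [Equiv.neg_apply, Left.neg_pos_iff]
    refine iSup_congr fun _ => ?_
    rw [hD.measure_Ici]
    congr 3
    ring
  unfold thresholdCost
  rw [h2]
  exact ((lowerCost_mono D).map_max (a := t) (b := -t)).symm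

theorem IsSymmetric.isTheta_zero {D : Measure ℝ} [IsProbabilityMeasure D] (hD : IsSymmetric D) :
    IsTheta D 0 := by
  intro t
  rw [hD.thresholdCost_eq, hD.thresholdCost_eq, abs_zero]
  exact lowerCost_mono D (abs_nonneg t)

theorem tendsto_mul_measureReal_Iic_neg {D : Measure ℝ} [IsProbabilityMeasure D]
    (hint : Integrable (fun x : ℝ => x) D) :
    Filter.Tendsto (fun v : ℝ => v * D.real (Set.Iic (-v))) Filter.atTop (nhds 0) := by
  have hlim : Filter.Tendsto (fun v : ℝ => ∫ x, (Set.Iic (-v)).indicator (fun x : ℝ => |x|) x ∂D)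
      Filter.atTop (nhds (∫ _, (0 : ℝ) ∂D)) := by
    refine tendsto_integral_filter_of_dominated_convergence (fun x => |x|)
      (Filter.Eventually.of_forall fun v =>
        (measurable_id.abs.indicator measurableSet_Iic).aestronglyMeasurable)
      (Filter.Eventually.of_forall fun v => Filter.Eventually.of_forall fun x => ?_) hint.abs
      (Filter.Eventually.of_forall fun x => ?_)
    · rw [Set.indicator_apply]
      split_ifs <;> simp
    · refine tendsto_const_nhds.congr' ?_
      filter_upwards [Filter.eventually_gt_atTop (-x)] with v hv
      rw [Set.indicator_of_notMem]
      simp only [Set.mem_Iic, not_le]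
      linarith
  rw [integral_zero] at hlim
  refine squeeze_zero' ?_ ?_ hlim
  · filter_upwards [Filter.eventually_ge_atTop 0] with v hv
    exact mul_nonneg hv measureReal_nonneg
  · filter_upwards [Filter.eventually_ge_atTop 0] with v hv
    rw [integral_indicator measurableSet_Iic, mul_comm, ← smul_eq_mul, ← setIntegral_const]
    refine setIntegral_mono_on (integrable_const v).integrableOn hint.abs.integrableOn
      measurableSet_Iic fun x hx => ?_
    rw [Set.mem_Iic] at hx
    exact le_abs.2 (Or.inr (by linarith))

/-- If the supremum `M` at `0` were not exceeded at `t`, then `Pr[a ≤ -v] * (v + t) ≤ M` for all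
`v ≥ 0`, which makes every `v * Pr[a ≤ -v]` with `v` bounded smaller than `M` by a constant factor;
for large `v` this quantity is small because the mean is finite. So the supremum could not be
`M`. -/
theorem IsSymmetric.lowerCost_zero_lt {D : Measure ℝ} [IsProbabilityMeasure D]
    (hD : IsSymmetric D) (hint : Integrable (fun x : ℝ => x) D) {t : ℝ} (ht : 0 < t) :
    lowerCost D 0 < lowerCost D t := by
  by_contra! hcon
  have hkey : ∀ v, 0 ≤ v → ENNReal.ofReal (D.real (Set.Iic (-v)) * (v + t)) ≤ lowerCost D 0 := by
    intro v hv
    refine le_trans ?_ hcon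
    refine le_trans (le_of_eq ?_) (le_iSup₂ (v + t) (by linarith))
    rw [ENNReal.ofReal_mul measureReal_nonneg, ofReal_measureReal]
    congr 3
    ring
  obtain ⟨V, hV0, hV⟩ : ∃ V, 0 < V ∧ ∀ v, V ≤ v → v * D.real (Set.Iic (-v)) ≤ t / 4 := by
    obtain ⟨V, hV⟩ := Filter.eventually_atTop.1
      ((tendsto_mul_measureReal_Iic_neg hint).eventually_le_const (by linarith : (0 : ℝ) < t / 4))
    exact ⟨max V 1, by positivity, fun v hv => hV v ((le_max_left _ _).trans hv)⟩
  have hfin : lowerCost D 0 ≤ ENNReal.ofReal (max V (t / 4)) := by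
    refine iSup₂_le fun v hv => ?_
    rw [zero_sub, ← ofReal_measureReal, ← ENNReal.ofReal_mul measureReal_nonneg]
    refine ENNReal.ofReal_le_ofReal ?_
    rcases le_total V v with h | h
    · exact le_max_of_le_right (by rw [mul_comm]; exact hV v h)
    · refine le_max_of_le_left ?_
      calc _ ≤ 1 * v := mul_le_mul_of_nonneg_right measureReal_le_one hv.le
        _ ≤ V := by linarith
  have hne : lowerCost D 0 ≠ ∞ := ne_top_of_le_ne_top ENNReal.ofReal_ne_top hfin
  set M := (lowerCost D 0).toReal with hM
  have hkeyR : ∀ v, 0 ≤ v → D.real (Set.Iic (-v)) * (v + t) ≤ M := fun v hv =>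
    (ENNReal.ofReal_le_iff_le_toReal hne).1 (hkey v hv)
  have hMt : t / 2 ≤ M := by
    have h := hkeyR 0 le_rfl
    rw [neg_zero, zero_add] at h
    have := mul_le_mul_of_nonneg_right hD.half_le_measureReal_Iic_zero ht.le
    linarith
  -- values above `V` contribute at most `t / 4 ≤ M / 2`; below `V` a factor `V / (V + t)` is gained
  have hup : lowerCost D 0 ≤ ENNReal.ofReal (max (M / 2) (M * (V / (V + t)))) := by
    refine iSup₂_le fun v hv => ?_
    rw [zero_sub, ← ofReal_measureReal, ← ENNReal.ofReal_mul measureReal_nonneg]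
    refine ENNReal.ofReal_le_ofReal ?_
    rcases le_total V v with h | h
    · refine le_max_of_le_left ?_
      have := hV v h
      linarith
    · refine le_max_of_le_right ?_
      have h1 := hkeyR v hv.le
      rw [mul_div_assoc', le_div_iff₀ (by linarith)]
      have hp : 0 ≤ D.real (Set.Iic (-v)) := measureReal_nonneg
      have h2 : D.real (Set.Iic (-v)) * v * (V + t) ≤ D.real (Set.Iic (-v)) * (v + t) * V := by
        nlinarith [mul_nonneg hp (mul_nonneg ht.le (sub_nonneg.2 h))]
      exact h2.trans (mul_le_mul_of_nonneg_right h1 hV0.le)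
  have hMpos : 0 < M := by linarith
  have hlt : max (M / 2) (M * (V / (V + t))) < M := by
    refine max_lt (by linarith) ?_
    rw [mul_div_assoc', div_lt_iff₀ (by linarith)]
    nlinarith
  have := (ENNReal.le_ofReal_iff_toReal_le hne (by positivity)).1 hup
  linarith

theorem IsSymmetric.eq_zero_of_isTheta {D : Measure ℝ} [IsProbabilityMeasure D]
    (hD : IsSymmetric D) (hint : Integrable (fun x : ℝ => x) D) {t : ℝ} (ht : IsTheta D t) :
    t = 0 := by
  by_contra hne
  have h := ht 0
  rw [hD.thresholdCost_eq, hD.thresholdCost_eq, abs_zero] at h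
  exact absurd h (not_le.2 (hD.lowerCost_zero_lt hint (abs_pos.2 hne)))

end NoisySelection

theorem mainTheorem3 (n : ℕ) (hn : 0 < n) (A : Fin n → MeasureTheory.Measure ℝ)
    [∀ i, MeasureTheory.IsProbabilityMeasure (A i)]
    (htail : ∀ i, NoisySelection.HasBoundedTail (A i))
    (hsymm : ∀ i, NoisySelection.IsSymmetric (A i)) :
    -- `0` is a valid choice of `θ(A i)`, and the only one if `A i` has a finite mean
    (∀ i, NoisySelection.IsTheta (A i) 0) ∧
    (∀ i, MeasureTheory.Integrable (fun x : ℝ => x) (A i) →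
      ∀ t : ℝ, NoisySelection.IsTheta (A i) t → t = 0) ∧
    -- Greedy coincides with the offset algorithm for `θ`
    (∀ θ : Fin n → ℝ, (∀ i, NoisySelection.IsTheta (A i) (θ i)) →
      (∀ i, ¬ MeasureTheory.Integrable (fun x : ℝ => x) (A i) → θ i = 0) →
      ∀ alg : NoisySelection.Algorithm n,
        NoisySelection.IsOffset θ alg ↔ NoisySelection.IsGreedy alg) ∧
    -- Greedy is a 57000-approximation to the optimal regret, for every way of breaking ties
    (∀ (alg : NoisySelection.Algorithm n) [ProbabilityTheory.IsMarkovKernel alg],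
      NoisySelection.IsGreedy alg →
        NoisySelection.regret A alg ≤ 57000 * NoisySelection.optRegret A) := by
  have huniq : ∀ i, MeasureTheory.Integrable (fun x : ℝ => x) (A i) →
      ∀ t : ℝ, NoisySelection.IsTheta (A i) t → t = 0 :=
    fun i hint _ ht => (hsymm i).eq_zero_of_isTheta hint ht
  refine ⟨fun i => (hsymm i).isTheta_zero, huniq, fun θ hθ hθ0 alg => ?_, fun alg _ halg => ?_⟩
  · have hzero : ∀ i, θ i = 0 := fun i => by
      by_cases hint : MeasureTheory.Integrable (fun x : ℝ => x) (A i)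
      · exact huniq i hint _ (hθ i)
      · exact hθ0 i hint
    simp [NoisySelection.IsOffset, NoisySelection.IsGreedy, hzero]
  · refine (NoisySelection.greedy_regret_le hn hsymm halg).trans ?_
    gcongr
    norm_num
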